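/- Let $\mathbb F$ be a field of characteristic different from $2$. A Lie superalgebra over $\mathbb F$ is a $\mathbb Z/2$-graded vector space $L=L_{\bar 0}\oplus L_{\bar 1}$ with a bilinear bracket $[\cdot,\cdot]$ such that $[L_i,L_j]\subseteq L_{i+j}$ and, for homogeneous $x,y,z$ of degrees $|x|,|y|,|z|$, one has $[x,y]=-(-1)^{|x||y|}[y,x]$ and $$(-1)^{|x||z|}[x,[y,z]]+(-1)^{|y||x|}[y,[z,x]]+(-1)^{|z||y|}[z,[x,y]]=0 .$$ It is nilpotent if its lower central series $L\supseteq[L,L]\supseteq[L,[L,L]]\supseteq\cdots$ reaches $0$. A graded subspace $U$ (one with $U=(U\cap L_{\bar 0})\oplus(U\cap L_{\bar 1})$) has dimension $(r,s)$ if $\dim (U\cap L_{\bar 0})=r$ and $\dim (U\cap L_{\bar 1})=s$, and similarly for graded quotients. Let $Z(L)=\{z\in L: [z,x]=0 \text{ for all } x\in L\}$. For a finite-dimensional $L$, the superbreadth is $b(L)=(r,s)$ if $r+s$ is the maximum of $\dim \operatorname{ad}_x(L)$ over all $x\in L$ (homogeneous or not), where $\operatorname{ad}_x=[x,\cdot\,]$,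 and $(r,s)$ is the dimension of a graded image $\operatorname{ad}_x(L)$ attaining this maximum; if graded images attaining it have different dimensions $(r,s)$, the one with the largest $r$ is taken. **Theorem.** Let $L$ be a finite-dimensional nilpotent Lie superalgebra over $\mathbb F$. Then $b(L)=(2,0)$ if and only if one of the following conditions holds: 1. $\dim [L,L]=(2,0)$; 2. $\dim [L,L]=(3,0)$ and $\dim L/Z(L)=(0,2)$; 3. $\dim [L,L]=(3,0)$ and $\dim L/Z(L)=(3,0)$. -/

import Mathlib

open Module

universe u v

/-- The structure of a Lie superalgebra over the field `F` on the vector space `L`: a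
`ℤ/2`-grading `L = part 0 ⊕ part 1` together with a bilinear bracket which respects the grading,
is graded skew-symmetric, and satisfies the graded Jacobi identity. -/
structure LieSuperalgebra (F : Type u) (L : Type v) [Field F] [AddCommGroup L] [Module F L] where
  /-- The even part `part 0` and the odd part `part 1`. -/
  part : ZMod 2 → Submodule F L
  isCompl : IsCompl (part 0) (part 1)
  /-- The bracket `[x, y] = bracket x y`; thus `bracket x` is the map `ad x`. -/
  bracket : L →ₗ[F] L →ₗ[F] L
  bracket_mem : ∀ (i j : ZMod 2) (x y : L), x ∈ part i → y ∈ part j →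
    bracket x y ∈ part (i + j)
  skew : ∀ (i j : ZMod 2) (x y : L), x ∈ part i → y ∈ part j →
    bracket x y = -((-1 : F) ^ (i.val * j.val) • bracket y x)
  jacobi : ∀ (i j k : ZMod 2) (x y z : L), x ∈ part i → y ∈ part j → z ∈ part k →
    (-1 : F) ^ (i.val * k.val) • bracket x (bracket y z)
      + (-1 : F) ^ (j.val * i.val) • bracket y (bracket z x)
      + (-1 : F) ^ (k.val * j.val) • bracket z (bracket x y) = 0

namespace LieSuperalgebra

variable {F : Type u} {L : Type v} [Field F] [AddCommGroup L] [Module F L]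

/-- The subspace `[L, L]`, spanned by all brackets. -/
def derived (S : LieSuperalgebra F L) : Submodule F L :=
  Submodule.map₂ S.bracket ⊤ ⊤

/-- The center `Z(L) = {z | [z, x] = 0 for all x}`. -/
def center (S : LieSuperalgebra F L) : Submodule F L :=
  LinearMap.ker S.bracket

/-- The lower central series `L, [L, L], [L, [L, L]], …`. -/
def lowerCentral (S : LieSuperalgebra F L) : ℕ → Submodule F L
  | 0 => ⊤
  | n + 1 => Submodule.map₂ S.bracket ⊤ (S.lowerCentral n)

/-- A Lie superalgebra is nilpotent if its lower central series reaches `0`. -/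
def IsNilpotent (S : LieSuperalgebra F L) : Prop :=
  ∃ n : ℕ, S.lowerCentral n = ⊥

/-- A subspace is graded if it is the sum of its even part and its odd part. -/
def IsGraded (S : LieSuperalgebra F L) (U : Submodule F L) : Prop :=
  (U ⊓ S.part 0) ⊔ (U ⊓ S.part 1) = U

/-- The superdimension `(dim U₀, dim U₁)` of a graded subspace `U`. -/
noncomputable def sdim (S : LieSuperalgebra F L) (U : Submodule F L) : ℕ × ℕ :=
  (finrank F ↥(U ⊓ S.part 0), finrank F ↥(U ⊓ S.part 1))

/-- The superdimension of the quotient `L / I` by a graded ideal `I`; the even and odd parts of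
`L / I` are the images of the even and odd parts of `L`. -/
noncomputable def sdimQuotient (S : LieSuperalgebra F L) (I : Submodule F L) : ℕ × ℕ :=
  (finrank F ↥((S.part 0).map I.mkQ), finrank F ↥((S.part 1).map I.mkQ))

/-- `b(L) = (r, s)`: the maximum of the dimensions of the images of `ad x`, over all `x` in `L`
(homogeneous or not), is `r + s`, and `(r, s)` is the superdimension of an image of this maximal
dimension (an image which is a graded subspace, so that its superdimension makes sense). If graded
images of maximal dimension have different superdimensions, the one with the largest even part is
taken, so that there is at most one such pair. -/
structure HasSuperbreadth (S : LieSuperalgebra F L) (r s : ℕ) : Prop where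
  attained : ∃ x : L, S.IsGraded (LinearMap.range (S.bracket x)) ∧
    S.sdim (LinearMap.range (S.bracket x)) = (r, s)
  finrank_le : ∀ y : L, finrank F ↥(LinearMap.range (S.bracket y)) ≤ r + s
  even_le : ∀ y : L, S.IsGraded (LinearMap.range (S.bracket y)) →
    finrank F ↥(LinearMap.range (S.bracket y)) = r + s →
    (S.sdim (LinearMap.range (S.bracket y))).1 ≤ r

end LieSuperalgebra

/-! ### Pairs of linear maps whose pencil has rank at most two -/

section RankTwo

variable {F V W : Type*} [Field F] [AddCommGroup V] [Module F V] [AddCommGroup W] [Module F W]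
  [FiniteDimensional F W]

/-! The engine is perturbation of a rank-two map `A` by `B` when `B`, `A + B` and `A - B` also have
rank at most two. A first-order argument gives `B (ker A) ⊆ range A`; a second-order one gives `B w
∈ range A` whenever `B k = A w` with `A k = 0`. Only the scalars `1` and `-1` enter, so small fields
such as `𝔽₃` are covered.

If the superbreadth is `(2, 0)`, this applies to `ad x` with image of dimension `(2, 0)` and to
every `ad y`. It forces the even and odd parts to commute (`HasSuperbreadth.partsCommute`), so `[L,
L]` is even and the bracket splits into an alternating form on the even part and a symmetric form on
the odd part. If moreover `dim [L, L] ≥ 3`, some homogeneous element has rank two within its own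
part, and then the bracket of the other part vanishes (`PartsCommute.bracket_eq_zero`). What remains
is one form of partial ranks at most two: modulo its radical it is `Λ²` of a 3-space or `Sym²` of a
2-space, giving conditions 3 and 2.

Conversely each condition makes `[L, L]` even, hence the parts commute. Ranks are then at most two
because of `dim [L, L]`, because of `dim L/Z(L)`, or because `[x, x] = 0` on a 3-dimensional
quotient. Rank two occurs, since a form all of whose partial maps have rank at most one has its
values on a line. -/

theorem LinearMap.exists_eq_of_finrank_range_le_two {T : V →ₗ[F] W}
    (hT : finrank F (LinearMap.range T) ≤ 2) {a b : V}
    (h : ∀ s t : F, s • T a + t • T b = 0 → s = 0 ∧ t = 0) (c : V) :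
    ∃ s t : F, T c = s • T a + t • T b := by
  have hli : LinearIndependent F ![T a, T b] := LinearIndependent.pair_iff.2 h
  have hle : Submodule.span F (Set.range ![T a, T b]) ≤ LinearMap.range T := by
    rw [Submodule.span_le]
    rintro _ ⟨i, rfl⟩
    fin_cases i <;> simp
  have heq := Submodule.eq_of_le_of_finrank_le hle (by
    rw [finrank_span_eq_card hli]; simpa using hT)
  have hc : T c ∈ Submodule.span F (Set.range ![T a, T b]) := heq ▸ LinearMap.mem_range_self T c
  simp only [Matrix.range_cons, Matrix.range_empty, Set.union_empty, Set.singleton_union] at hc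
  obtain ⟨s, t, hst⟩ := Submodule.mem_span_pair.1 hc
  exact ⟨s, t, hst.symm⟩

/-- For linear maps such that `B`, `A + B` and `A - B` have rank at most two and `A` has rank at
least two, `B` maps the kernel of `A` into the range of `A`. -/
theorem LinearMap.apply_mem_range_of_apply_eq_zero (h2 : (2 : F) ≠ 0) {A B : V →ₗ[F] W}
    (hB : finrank F (LinearMap.range B) ≤ 2) (hadd : finrank F (LinearMap.range (A + B)) ≤ 2)
    (hsub : finrank F (LinearMap.range (A - B)) ≤ 2) {e f k : V}
    (h : ∀ s t : F, s • A e + t • A f = 0 → s = 0 ∧ t = 0) (hk : A k = 0) :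
    B k ∈ LinearMap.range A := by
  by_contra hn
  -- With `B k` outside `range A`, both `A + B` and `A - B` have image spanned by `B k` and `A g`.
  -- Adding the two expansions at `g'` puts `2 • A g'` in that plane, hence on the line of `A g`, a
  -- contradiction.
  have key : ∀ (s : F) (g g' : V), (∀ s t : F, s • A g + t • A g' = 0 → s = 0 ∧ t = 0) →
      B g = s • B k → False := by
    intro s g g' hg hs
    have hnot : ∀ (c : F) (m : V), c • B k = A m → c = 0 := by
      intro c m hc
      by_contra hc0
      exact hn ⟨c⁻¹ • m, by rw [map_smul, ← hc, smul_smul, inv_mul_cancel₀ hc0, one_smul]⟩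
    have ind : ∀ c d : F, c • B k + d • A g = 0 → c = 0 ∧ d = 0 := by
      intro c d hcd
      have hc : c = 0 := hnot c (-d • g) (by rw [map_smul]; linear_combination (norm := module) hcd)
      refine ⟨hc, (hg d 0 ?_).1⟩
      rw [hc] at hcd
      linear_combination (norm := module) hcd
    obtain ⟨a, b, hab⟩ := LinearMap.exists_eq_of_finrank_range_le_two hadd (a := k) (b := g)
      (by
        intro c d hcd
        simp only [LinearMap.add_apply, hk, hs] at hcd
        obtain ⟨h1, h3⟩ := ind (c + d * s) d (by linear_combination (norm := module) hcd)
        subst h3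
        simpa using h1) g'
    obtain ⟨a', b', hab'⟩ := LinearMap.exists_eq_of_finrank_range_le_two hsub (a := k) (b := g)
      (by
        intro c d hcd
        simp only [LinearMap.sub_apply, hk, hs] at hcd
        obtain ⟨h1, h3⟩ := ind (-c - d * s) d (by linear_combination (norm := module) hcd)
        subst h3
        simpa using h1) g'
    simp only [LinearMap.add_apply, LinearMap.sub_apply, hk, hs] at hab hab'
    have hsum : (2 : F) • A g' = (a + b * s - a' - b' * s) • B k + (b + b') • A g := by
      linear_combination (norm := module) hab + hab'
    have h0 := hnot (a + b * s - a' - b' * s) ((2 : F) • g' - (b + b') • g) (by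
      simp only [map_sub, map_smul]; linear_combination (norm := module) -hsum)
    rw [h0] at hsum
    exact h2 (hg (-(b + b')) 2 (by linear_combination (norm := module) hsum)).2
  -- A vector `g` with `B g` on the line of `B k` and `A g ≠ 0` exists: `e` itself, or a combination
  -- `f - t • e`, because `range B` is at most a plane.
  by_cases he : ∃ s : F, B e = s • B k
  · obtain ⟨s, hs⟩ := he
    exact key s e f h hs
  · have hk0 : B k ≠ 0 := fun h0 => hn (h0 ▸ Submodule.zero_mem _)
    obtain ⟨s, t, hst⟩ := LinearMap.exists_eq_of_finrank_range_le_two hB (a := k) (b := e)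
      (by
        intro c d hcd
        have hd : d = 0 := by
          by_contra hd
          refine he ⟨-(d⁻¹ * c), ?_⟩
          have := congrArg (fun v => d⁻¹ • v) hcd
          simp only [smul_add, smul_smul, inv_mul_cancel₀ hd, smul_zero] at this
          linear_combination (norm := module) this
        subst hd
        simpa [hk0] using hcd) f
    refine key s (f - t • e) e (fun c d hcd => ?_) ?_
    · simp only [map_sub, map_smul] at hcd
      obtain ⟨h1, h3⟩ := h (d - c * t) c (by linear_combination (norm := module) hcd)
      subst h3
      simpa using h1
    · simp only [map_sub, map_smul]
      linear_combination (norm := module) hst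

/-- The second-order companion: `(A + t B)(k - t w) = -t² B w`. If `B w` were outside `range A`, the
images of `A ± B` would both be the plane of `A w` and `B w`, which would confine `range A` to the
line of `A w`. -/
theorem LinearMap.apply_mem_range_of_apply_eq_apply (h2 : (2 : F) ≠ 0) {A B : V →ₗ[F] W}
    (hB : finrank F (LinearMap.range B) ≤ 2) (hadd : finrank F (LinearMap.range (A + B)) ≤ 2)
    (hsub : finrank F (LinearMap.range (A - B)) ≤ 2) {e f k w : V}
    (h : ∀ s t : F, s • A e + t • A f = 0 → s = 0 ∧ t = 0) (hk : A k = 0) (hw : B k = A w) :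
    B w ∈ LinearMap.range A := by
  by_cases hw0 : A w = 0
  · exact LinearMap.apply_mem_range_of_apply_eq_zero h2 hB hadd hsub h hw0
  by_contra hn
  have hnot : ∀ (c : F) (m : V), c • B w = A m → c = 0 := by
    intro c m hc
    by_contra hc0
    exact hn ⟨c⁻¹ • m, by rw [map_smul, ← hc, smul_smul, inv_mul_cancel₀ hc0, one_smul]⟩
  have ind : ∀ c d : F, c • A w + d • B w = 0 → c = 0 ∧ d = 0 := by
    intro c d hcd
    have hd : d = 0 := hnot d (-c • w) (by rw [map_smul]; linear_combination (norm := module) hcd)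
    subst hd
    simpa [hw0] using hcd
  have key : ∀ g : V, ∃ c : F, (2 : F) • A g = c • A w := by
    intro g
    obtain ⟨a, b, hab⟩ := LinearMap.exists_eq_of_finrank_range_le_two hadd (a := k) (b := w)
      (by
        intro c d hcd
        simp only [LinearMap.add_apply, hk, hw] at hcd
        obtain ⟨h1, h3⟩ := ind (c + d) d (by linear_combination (norm := module) hcd)
        subst h3
        simpa using h1) g
    obtain ⟨a', b', hab'⟩ := LinearMap.exists_eq_of_finrank_range_le_two hsub (a := k) (b := w)
      (by
        intro c d hcd
        simp only [LinearMap.sub_apply, hk, hw] at hcd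
        obtain ⟨h1, h3⟩ := ind (-c + d) (-d) (by linear_combination (norm := module) hcd)
        have h3' : d = 0 := by simpa using h3
        subst h3'
        simpa using h1) g
    simp only [LinearMap.add_apply, LinearMap.sub_apply, hk, hw] at hab hab'
    have hsum : (2 : F) • A g = (a + b - a' + b') • A w + (b - b') • B w := by
      linear_combination (norm := module) hab + hab'
    have h0 := hnot (b - b') ((2 : F) • g - (a + b - a' + b') • w) (by
      simp only [map_sub, map_smul]; linear_combination (norm := module) -hsum)
    rw [h0] at hsum
    exact ⟨a + b - a' + b', by linear_combination (norm := module) hsum⟩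
  obtain ⟨c, hc⟩ := key e
  obtain ⟨d, hd⟩ := key f
  obtain ⟨h3, h4⟩ := h (d * 2) (-c * 2) (by linear_combination (norm := module) d • hc - c • hd)
  have hd0 : d = 0 := by simpa [h2] using h3
  rw [hd0] at hd
  exact h2 (h 0 2 (by linear_combination (norm := module) hd)).2

end RankTwo

/-! ### Bilinear maps with partial maps of small rank -/

section Bilinear

variable {F V W : Type*} [Field F] [AddCommGroup V] [Module F V] [AddCommGroup W] [Module F W]

theorem LinearMap.finrank_range_le_one {T : V →ₗ[F] W}
    (h : ¬ ∃ a b : V, ∀ s t : F, s • T a + t • T b = 0 → s = 0 ∧ t = 0) :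
    finrank F (LinearMap.range T) ≤ 1 := by
  by_contra hlt
  push Not at hlt
  apply h
  obtain ⟨f, hf⟩ := exists_linearIndependent_of_le_finrank (R := F) hlt
  obtain ⟨a, ha⟩ := (f 0).2
  obtain ⟨b, hb⟩ := (f 1).2
  refine ⟨a, b, fun s t hst => ?_⟩
  have := Fintype.linearIndependent_iff.1 hf ![s, t] (by
    apply Subtype.ext
    simpa [Fin.sum_univ_two, ← ha, ← hb] using hst)
  exact ⟨this 0, this 1⟩

/-- If all maps `B x` have rank at most one, and every `B y` is of the form `B · y'`, then all
values of `B` lie on one line. -/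
theorem LinearMap.exists_forall_eq_smul {B : V →ₗ[F] V →ₗ[F] W}
    (hflip : ∀ y, ∃ y', ∀ z, B y z = B z y')
    (h : ∀ x a b : V, ¬ ∀ s t : F, s • B x a + t • B x b = 0 → s = 0 ∧ t = 0) :
    ∃ u : W, ∀ y z, ∃ s : F, B y z = s • u := by
  by_cases h0 : ∀ y z, B y z = 0
  · exact ⟨0, fun y z => ⟨0, by simp [h0]⟩⟩
  push Not at h0
  obtain ⟨a, b, hab⟩ := h0
  have dep : ∀ x p q : V, B x p ≠ 0 → ∃ s : F, B x q = s • B x p := by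
    intro x p q hp
    have := h x p q
    push Not at this
    obtain ⟨s, t, hst, hne⟩ := this
    have ht : t ≠ 0 := by
      intro ht
      have hs : s = 0 := by
        rw [ht] at hst
        simpa [hp] using hst
      exact hne hs ht
    refine ⟨-(t⁻¹ * s), ?_⟩
    have := congrArg (fun v => t⁻¹ • v) hst
    simp only [smul_add, smul_smul, inv_mul_cancel₀ ht, smul_zero] at this
    linear_combination (norm := module) this
  have dep' : ∀ (w : W) (x p q : V), B x p ≠ 0 → (∃ s : F, B x p = s • w) →
      ∃ s : F, B x q = s • w := by
    rintro w x p q hp ⟨s, hs⟩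
    obtain ⟨t, ht⟩ := dep x p q hp
    exact ⟨t * s, by rw [ht, hs, smul_smul]⟩
  refine ⟨B a b, fun c d => ?_⟩
  obtain ⟨a', ha'⟩ := hflip a
  obtain ⟨c', hc'⟩ := hflip c
  by_cases hcb : B c b = 0
  · by_cases had : B a d = 0
    -- With both mixed values zero, `B (a + c)` takes the values `B a b` at `b` and `B c d` at `d`,
    -- and its image is a line.
    · have hne : B (a + c) b ≠ 0 := by simpa [hcb] using hab
      obtain ⟨s, hs⟩ := dep (a + c) b d hne
      exact ⟨s, by simpa [hcb, had] using hs⟩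
    · rw [hc']
      exact dep' _ d a' c' (ha' d ▸ had) (ha' d ▸ dep a b d hab)
  · refine dep' _ c b d hcb ?_
    rw [hc']
    exact dep' _ b a' c' (ha' b ▸ hab) ⟨1, by rw [← ha', one_smul]⟩

variable [FiniteDimensional F W] {B : V →ₗ[F] V →ₗ[F] W}

/-- An alternating bilinear map all of whose partial maps have rank at most two, and whose values
do not span a space of dimension at most two, is, up to its radical, the exterior square of a
three-dimensional space. -/
theorem LinearMap.exists_three_of_alternating (h2 : (2 : F) ≠ 0) (halt : ∀ y, B y y = 0)
    (hr : ∀ y, finrank F (LinearMap.range (B y)) ≤ 2)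
    (hW : ∀ u v : W, ¬ ∀ y z, ∃ s t : F, B y z = s • u + t • v) {x e f : V}
    (h : ∀ s t : F, s • B x e + t • B x f = 0 → s = 0 ∧ t = 0) :
    (∀ s t r : F, s • B x e + t • B x f + r • B e f = 0 → s = 0 ∧ t = 0 ∧ r = 0) ∧
      ∀ v, ∃ a b c : F, ∀ y, B y (v - a • x - b • e - c • f) = 0 := by
  have hneg : ∀ y z, B y z = -B z y := by
    intro y z
    have := halt (y + z)
    simp only [map_add, LinearMap.add_apply, halt] at this
    linear_combination (norm := module) this
  have F1 : ∀ {x e f k : V}, (∀ s t : F, s • B x e + t • B x f = 0 → s = 0 ∧ t = 0) →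
      B x k = 0 → ∀ y, ∃ s t : F, B y k = s • B x e + t • B x f := by
    intro x e f k h hk y
    obtain ⟨m, hm⟩ := LinearMap.apply_mem_range_of_apply_eq_zero h2 (hr y)
      (by rw [← map_add]; exact hr _) (by rw [← map_sub]; exact hr _) h hk
    rw [← hm]
    exact LinearMap.exists_eq_of_finrank_range_le_two (hr x) h m
  have F2 : ∀ {k w y : V}, B x k = 0 → B y k = B x w →
      ∃ s t : F, B y w = s • B x e + t • B x f := by
    intro k w y hk hw
    obtain ⟨m, hm⟩ := LinearMap.apply_mem_range_of_apply_eq_apply h2 (hr y)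
      (by rw [← map_add]; exact hr _) (by rw [← map_sub]; exact hr _) h hk hw
    rw [← hm]
    exact LinearMap.exists_eq_of_finrank_range_le_two (hr x) h m
  have hdec : ∀ v, ∃ b c : F, B x (v - b • e - c • f) = 0 := by
    intro v
    obtain ⟨b, c, hbc⟩ := LinearMap.exists_eq_of_finrank_range_le_two (hr x) h v
    refine ⟨b, c, ?_⟩
    simp only [map_sub, map_smul]
    linear_combination (norm := module) hbc
  -- Otherwise, decomposing both arguments along `e`, `f` and `ker (B x)`, every value of `B` would
  -- lie in the plane of `B x e` and `B x f`.
  have hw : ∀ s t : F, B e f ≠ s • B x e + t • B x f := by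
    intro s t hst
    refine hW (B x e) (B x f) fun y z => ?_
    obtain ⟨b, c, hy⟩ := hdec y
    obtain ⟨b', c', hz⟩ := hdec z
    obtain ⟨s1, t1, h1⟩ := F1 h hz y
    obtain ⟨s2, t2, h2'⟩ := F1 h hy e
    obtain ⟨s3, t3, h3⟩ := F1 h hy f
    simp only [map_sub, map_smul, halt, hneg e y, hneg f y, hneg f e] at h1 h2' h3
    refine ⟨s1 - b' * s2 - c' * s3 + (c' * b - b' * c) * s,
      t1 - b' * t2 - c' * t3 + (c' * b - b' * c) * t, ?_⟩
    linear_combination (norm := module) h1 - b' • h2' - c' • h3 + (c' * b - b' * c) • hst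
  have hmul : ∀ r s t : F, r • B e f = s • B x e + t • B x f → r = 0 := by
    intro r s t hrst
    by_contra hr0
    refine hw (r⁻¹ * s) (r⁻¹ * t) ?_
    rw [mul_smul, mul_smul, ← smul_add, ← hrst, smul_smul, inv_mul_cancel₀ hr0, one_smul]
  have ind : ∀ s t r : F, s • B x e + t • B x f + r • B e f = 0 → s = 0 ∧ t = 0 ∧ r = 0 := by
    intro s t r hstr
    have hr0 := hmul r (-s) (-t) (by linear_combination (norm := module) hstr)
    subst hr0
    obtain ⟨hs, ht⟩ := h s t (by linear_combination (norm := module) hstr)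
    exact ⟨hs, ht, rfl⟩
  have he : ∀ s t : F, s • B e x + t • B e f = 0 → s = 0 ∧ t = 0 := by
    intro s t hst
    rw [hneg e x] at hst
    obtain ⟨h1, -, h3⟩ := ind (-s) 0 t (by linear_combination (norm := module) hst)
    exact ⟨by simpa using h1, h3⟩
  have hf : ∀ s t : F, s • B f x + t • B f e = 0 → s = 0 ∧ t = 0 := by
    intro s t hst
    rw [hneg f x, hneg f e] at hst
    obtain ⟨-, h1, h3⟩ := ind 0 (-s) (-t) (by linear_combination (norm := module) hst)
    exact ⟨by simpa using h1, by simpa using h3⟩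
  refine ⟨ind, fun v => ?_⟩
  obtain ⟨b, c, hk⟩ := hdec v
  set k := v - b • e - c • f with hkdef
  obtain ⟨α, β, h1⟩ := F1 h hk e
  obtain ⟨δ, γ, h3⟩ := F1 h hk f
  -- The second-order lemma at `y = e`, `y = f` and `y = e + f` puts `β`, `-δ` and `γ - α` times `B
  -- e f` into the plane of `B x e` and `B x f`. Hence `k` acts on `e` and `f` as `-γ • x` does.
  have hβ : β = 0 := by
    obtain ⟨s, t, hst⟩ := F2 (w := α • e + β • f) hk (by simpa using h1)
    simp only [map_add, map_smul, halt] at hst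
    exact hmul β s t (by linear_combination (norm := module) hst)
  have hδ : δ = 0 := by
    obtain ⟨s, t, hst⟩ := F2 (w := δ • e + γ • f) hk (by simpa using h3)
    simp only [map_add, map_smul, halt, hneg f e] at hst
    simpa using hmul (-δ) s t (by linear_combination (norm := module) hst)
  subst hβ hδ
  have hγ : γ - α = 0 := by
    obtain ⟨s, t, hst⟩ := F2 (y := e + f) (w := α • e + γ • f) hk (by
      simp only [map_add, map_smul, LinearMap.add_apply]
      linear_combination (norm := module) h1 + h3)
    simp only [map_add, map_smul, LinearMap.add_apply, halt, hneg f e] at hst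
    exact hmul _ s t (by linear_combination (norm := module) hst)
  have hγ' : γ = α := sub_eq_zero.1 hγ
  subst hγ'
  refine ⟨-γ, b, c, fun y => ?_⟩
  have hn : v - (-γ) • x - b • e - c • f = k + γ • x := by rw [hkdef]; module
  rw [hn]
  -- The vector `k + γ • x` is killed by `B x`, `B e` and `B f`, so its products lie in all three
  -- images. These are the coordinate planes of a 3-space, with zero intersection.
  obtain ⟨s1, t1, e1⟩ := F1 h (k := k + γ • x) (by simp [hk, halt]) y
  obtain ⟨s2, t2, e2⟩ := F1 he (k := k + γ • x) (by
    simp only [map_add, map_smul, hneg e x]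
    linear_combination (norm := module) h1) y
  obtain ⟨s3, t3, e3⟩ := F1 hf (k := k + γ • x) (by
    simp only [map_add, map_smul, hneg f x]
    linear_combination (norm := module) h3) y
  rw [hneg e x] at e2
  rw [hneg f x, hneg f e] at e3
  obtain ⟨-, ht1, -⟩ := ind (s1 + s2) t1 (-t2) (by linear_combination (norm := module) e2 - e1)
  obtain ⟨hs1, -, -⟩ := ind s1 (t1 + s3) t3 (by linear_combination (norm := module) e3 - e1)
  rw [e1, hs1, ht1]
  simp

/-- A symmetric bilinear map all of whose partial maps have rank at most two, and whose values
do not span a space of dimension at most two, is, up to its radical, the symmetric square of a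
two-dimensional space. -/
theorem LinearMap.exists_two_of_symmetric (h2 : (2 : F) ≠ 0) (hsymm : ∀ y z, B y z = B z y)
    (hr : ∀ y, finrank F (LinearMap.range (B y)) ≤ 2)
    (hW : ∀ u v : W, ¬ ∀ y z, ∃ s t : F, B y z = s • u + t • v) {x a b : V}
    (h : ∀ s t : F, s • B x a + t • B x b = 0 → s = 0 ∧ t = 0) :
    ∃ e : V, (∀ s t r : F, s • B x x + t • B x e + r • B e e = 0 → s = 0 ∧ t = 0 ∧ r = 0) ∧
      ∀ v, ∃ c d : F, ∀ y, B y (v - c • x - d • e) = 0 := by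
  have F1 : ∀ {x e f k : V}, (∀ s t : F, s • B x e + t • B x f = 0 → s = 0 ∧ t = 0) →
      B x k = 0 → ∀ y, ∃ s t : F, B y k = s • B x e + t • B x f := by
    intro x e f k h hk y
    obtain ⟨m, hm⟩ := LinearMap.apply_mem_range_of_apply_eq_zero h2 (hr y)
      (by rw [← map_add]; exact hr _) (by rw [← map_sub]; exact hr _) h hk
    rw [← hm]
    exact LinearMap.exists_eq_of_finrank_range_le_two (hr x) h m
  have F2 : ∀ {e f k w y : V}, (∀ s t : F, s • B x e + t • B x f = 0 → s = 0 ∧ t = 0) →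
      B x k = 0 → B y k = B x w → ∃ s t : F, B y w = s • B x e + t • B x f := by
    intro e f k w y h hk hw
    obtain ⟨m, hm⟩ := LinearMap.apply_mem_range_of_apply_eq_apply h2 (hr y)
      (by rw [← map_add]; exact hr _) (by rw [← map_sub]; exact hr _) h hk hw
    rw [← hm]
    exact LinearMap.exists_eq_of_finrank_range_le_two (hr x) h m
  -- If `B x x = 0`, the second-order lemma with `k = x` and `w = y` puts every `B y y` in `range (B
  -- x)`. Polarization then puts all values there.
  have hxx : B x x ≠ 0 := by
    intro hx
    refine hW (B x a) (B x b) fun y z => ?_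
    obtain ⟨s1, t1, h1⟩ := F2 h hx (hsymm (y + z) x)
    obtain ⟨s2, t2, h3⟩ := F2 h hx (hsymm (y - z) x)
    have h4 : (4 : F) ≠ 0 := by
      have : (4 : F) = 2 * 2 := by norm_num
      rw [this]; exact mul_ne_zero h2 h2
    refine ⟨4⁻¹ * (s1 - s2), 4⁻¹ * (t1 - t2), ?_⟩
    simp only [map_add, map_sub, LinearMap.add_apply, LinearMap.sub_apply, hsymm z y] at h1 h3
    have h5 : (4 : F) • B y z = (s1 - s2) • B x a + (t1 - t2) • B x b := by
      linear_combination (norm := module) h1 - h3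
    rw [mul_smul, mul_smul, ← smul_add, ← h5, smul_smul, inv_mul_cancel₀ h4, one_smul]
  obtain ⟨e, he⟩ : ∃ e, ∀ s t : F, s • B x x + t • B x e = 0 → s = 0 ∧ t = 0 := by
    by_contra hne
    have hex : ∀ e, ∃ c : F, B x e = c • B x x := by
      intro e
      by_contra hc
      refine hne ⟨e, fun s t hst => ?_⟩
      have ht : t = 0 := by
        by_contra ht
        refine hc ⟨-(t⁻¹ * s), ?_⟩
        have := congrArg (fun v => t⁻¹ • v) hst
        simp only [smul_add, smul_smul, inv_mul_cancel₀ ht, smul_zero] at this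
        linear_combination (norm := module) this
      subst ht
      simpa [hxx] using hst
    obtain ⟨c, hc⟩ := hex a
    obtain ⟨d, hd⟩ := hex b
    obtain ⟨hd0, -⟩ := h d (-c) (by linear_combination (norm := module) d • hc - c • hd)
    rw [hd0] at hd
    exact one_ne_zero (h 0 1 (by linear_combination (norm := module) hd)).2
  have hdec : ∀ v, ∃ c d : F, B x (v - c • x - d • e) = 0 := by
    intro v
    obtain ⟨b, c, hbc⟩ := LinearMap.exists_eq_of_finrank_range_le_two (hr x) he v
    refine ⟨b, c, ?_⟩
    simp only [map_sub, map_smul]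
    linear_combination (norm := module) hbc
  have hw : ∀ s t : F, B e e ≠ s • B x x + t • B x e := by
    intro s t hst
    refine hW (B x x) (B x e) fun y z => ?_
    obtain ⟨c, d, hy⟩ := hdec y
    obtain ⟨c', d', hz⟩ := hdec z
    obtain ⟨s1, t1, h1⟩ := F1 he hz y
    obtain ⟨s2, t2, h3⟩ := F1 he hy e
    obtain ⟨s3, t3, h4⟩ := F1 he hy x
    simp only [map_sub, map_smul, hsymm e x, hsymm y x, hsymm y e] at h1 h3 h4
    refine ⟨s1 + c' * s3 + d' * s2 + c * c' + d * d' * s, t1 + c' * t3 + d' * t2 +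
      c' * d + d' * c + d * d' * t, ?_⟩
    linear_combination (norm := module) h1 + d' • h3 + c' • h4 + (d * d') • hst
  have hmul : ∀ r s t : F, r • B e e = s • B x x + t • B x e → r = 0 := by
    intro r s t hrst
    by_contra hr0
    refine hw (r⁻¹ * s) (r⁻¹ * t) ?_
    rw [mul_smul, mul_smul, ← smul_add, ← hrst, smul_smul, inv_mul_cancel₀ hr0, one_smul]
  have ind : ∀ s t r : F, s • B x x + t • B x e + r • B e e = 0 → s = 0 ∧ t = 0 ∧ r = 0 := by
    intro s t r hstr
    have hr0 := hmul r (-s) (-t) (by linear_combination (norm := module) hstr)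
    subst hr0
    obtain ⟨hs, ht⟩ := he s t (by linear_combination (norm := module) hstr)
    exact ⟨hs, ht, rfl⟩
  have hee : ∀ s t : F, s • B e x + t • B e e = 0 → s = 0 ∧ t = 0 := by
    intro s t hst
    rw [hsymm e x] at hst
    obtain ⟨-, h1, h3⟩ := ind 0 s t (by linear_combination (norm := module) hst)
    exact ⟨h1, h3⟩
  have hxe : ∀ s t : F, s • B (x + e) x + t • B (x + e) e = 0 → s = 0 ∧ t = 0 := by
    intro s t hst
    simp only [map_add, LinearMap.add_apply, hsymm e x] at hst
    obtain ⟨h1, -, h3⟩ := ind s (s + t) t (by linear_combination (norm := module) hst)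
    exact ⟨h1, h3⟩
  refine ⟨e, ind, fun v => ?_⟩
  obtain ⟨c, d, hk⟩ := hdec v
  refine ⟨c, d, fun y => ?_⟩
  set k := v - c • x - d • e with hkdef
  -- `B e k` lies in the images of both `B x` and `B e`, which meet in the line of `B x e`. The
  -- second-order lemma then kills the coefficient.
  have hek : B e k = 0 := by
    obtain ⟨s1, t1, e1⟩ := F1 he hk e
    obtain ⟨s2, t2, e2⟩ := LinearMap.exists_eq_of_finrank_range_le_two (hr e) hee k
    rw [hsymm e x] at e2
    obtain ⟨hs1, -, -⟩ := ind s1 (t1 - s2) (-t2) (by linear_combination (norm := module) e2 - e1)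
    subst hs1
    obtain ⟨s, t, hst⟩ := F2 (w := t1 • e) he hk (by
      simp only [map_smul]; linear_combination (norm := module) e1)
    have ht1 := hmul t1 s t (by simpa using hst)
    rw [e1, ht1]
    simp
  -- The images of `B x` and `B e` share the line of `B x e`; the image of `B (x + e)` is the third
  -- plane, needed to exclude it.
  obtain ⟨s1, t1, e1⟩ := F1 he hk y
  obtain ⟨s2, t2, e2⟩ := F1 hee hek y
  obtain ⟨s3, t3, e3⟩ := F1 hxe (k := k) (by simp [hk, hek]) y
  simp only [map_add, LinearMap.add_apply, hsymm e x] at e2 e3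
  obtain ⟨hs1, -, -⟩ := ind s1 (t1 - s2) (-t2) (by linear_combination (norm := module) e2 - e1)
  obtain ⟨h31, h32, h33⟩ := ind (s1 - s3) (t1 - s3 - t3) (-t3)
    (by linear_combination (norm := module) e3 - e1)
  have ht3 : t3 = 0 := by simpa using h33
  have ht1 : t1 = 0 := by linear_combination h32 - h31 + hs1 + ht3
  rw [e1, hs1, ht1]
  simp

end Bilinear

/-! ### Superalgebras whose even and odd parts commute -/

namespace LieSuperalgebra

variable {F : Type u} {L : Type v} [Field F] [AddCommGroup L] [Module F L]
  (S : LieSuperalgebra F L)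

theorem exists_add_eq {i j : ZMod 2} (hij : i ≠ j) (x : L) :
    ∃ y ∈ S.part i, ∃ z ∈ S.part j, y + z = x := by
  have h : ∀ x : L, ∃ y ∈ S.part 0, ∃ z ∈ S.part 1, y + z = x := fun x =>
    Submodule.mem_sup.1 (S.isCompl.sup_eq_top ▸ Submodule.mem_top)
  have hc : (i = 0 ∧ j = 1) ∨ (i = 1 ∧ j = 0) :=
    (by decide : ∀ i j : ZMod 2, i ≠ j → (i = 0 ∧ j = 1) ∨ (i = 1 ∧ j = 0)) i j hij
  rcases hc with ⟨rfl, rfl⟩ | ⟨rfl, rfl⟩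
  · exact h x
  · obtain ⟨y, hy, z, hz, h⟩ := h x
    exact ⟨z, hz, y, hy, by rw [add_comm, h]⟩

theorem eq_zero_of_mem {x : L} (h0 : x ∈ S.part 0) (h1 : x ∈ S.part 1) : x = 0 :=
  Submodule.disjoint_def.1 S.isCompl.disjoint x h0 h1

theorem bracket_even_even {x y : L} (hx : x ∈ S.part 0) (hy : y ∈ S.part 0) :
    S.bracket x y = -S.bracket y x := by
  simpa using S.skew 0 0 x y hx hy

theorem bracket_even_odd {x y : L} (hx : x ∈ S.part 0) (hy : y ∈ S.part 1) :
    S.bracket x y = -S.bracket y x := by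
  simpa using S.skew 0 1 x y hx hy

theorem bracket_odd_odd {x y : L} (hx : x ∈ S.part 1) (hy : y ∈ S.part 1) :
    S.bracket x y = S.bracket y x := by
  simpa [ZMod.val_one] using S.skew 1 1 x y hx hy

theorem bracket_self_even (h2 : (2 : F) ≠ 0) {x : L} (hx : x ∈ S.part 0) :
    S.bracket x x = 0 := by
  have h : (2 : F) • S.bracket x x = 0 := by
    linear_combination (norm := module) S.bracket_even_even hx hx
  simpa [h2] using h

/-- The even and the odd part commute with each other. -/
def PartsCommute : Prop :=
  ∀ i j : ZMod 2, i ≠ j → ∀ x ∈ S.part i, ∀ y ∈ S.part j, S.bracket x y = 0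

variable {S}

theorem partsCommute_of_even_odd
    (h : ∀ x ∈ S.part 0, ∀ y ∈ S.part 1, S.bracket x y = 0) : S.PartsCommute := by
  intro i j hij x hx y hy
  have hc : (i = 0 ∧ j = 1) ∨ (i = 1 ∧ j = 0) :=
    (by decide : ∀ i j : ZMod 2, i ≠ j → (i = 0 ∧ j = 1) ∨ (i = 1 ∧ j = 0)) i j hij
  rcases hc with ⟨rfl, rfl⟩ | ⟨rfl, rfl⟩
  · exact h x hx y hy
  · simpa [h y hy x hx] using S.bracket_even_odd hy hx

theorem bracket_mem_derived (x y : L) : S.bracket x y ∈ S.derived :=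
  Submodule.apply_mem_map₂ _ Submodule.mem_top Submodule.mem_top

theorem PartsCommute.bracket_add (hS : S.PartsCommute) {i j : ZMod 2} (hij : i ≠ j)
    {x y x' y' : L} (hx : x ∈ S.part i) (hx' : x' ∈ S.part j) (hy : y ∈ S.part i)
    (hy' : y' ∈ S.part j) :
    S.bracket (x + x') (y + y') = S.bracket x y + S.bracket x' y' := by
  simp [hS i j hij x hx y' hy', hS j i hij.symm x' hx' y hy]

theorem PartsCommute.derived_le (hS : S.PartsCommute) {U : Submodule F L} {i j : ZMod 2}
    (hij : i ≠ j) (hi : ∀ x ∈ S.part i, ∀ y ∈ S.part i, S.bracket x y ∈ U)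
    (hj : ∀ x ∈ S.part j, ∀ y ∈ S.part j, S.bracket x y ∈ U) : S.derived ≤ U := by
  refine Submodule.map₂_le.2 fun x _ y _ => ?_
  obtain ⟨x0, hx0, x1, hx1, rfl⟩ := S.exists_add_eq hij x
  obtain ⟨y0, hy0, y1, hy1, rfl⟩ := S.exists_add_eq hij y
  rw [hS.bracket_add hij hx0 hx1 hy0 hy1]
  exact U.add_mem (hi _ hx0 _ hy0) (hj _ hx1 _ hy1)

theorem PartsCommute.derived_le_even (hS : S.PartsCommute) : S.derived ≤ S.part 0 :=
  hS.derived_le (i := 0) (j := 1) (by decide) (fun _ hx _ hy => S.bracket_mem 0 0 _ _ hx hy)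
    (fun _ hx _ hy => S.bracket_mem 1 1 _ _ hx hy)

/-- The bracket is skew on the even part and symmetric on the odd part, so changing the sign of the
even component exchanges left and right multiplication. -/
theorem PartsCommute.exists_flip (hS : S.PartsCommute) (y : L) :
    ∃ y', ∀ z, S.bracket y z = S.bracket z y' := by
  have h01 : (0 : ZMod 2) ≠ 1 := by decide
  obtain ⟨y0, hy0, y1, hy1, rfl⟩ := S.exists_add_eq h01 y
  refine ⟨-y0 + y1, fun z => ?_⟩
  obtain ⟨z0, hz0, z1, hz1, rfl⟩ := S.exists_add_eq h01 z
  rw [hS.bracket_add h01 hy0 hy1 hz0 hz1,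
    hS.bracket_add h01 hz0 hz1 ((S.part 0).neg_mem hy0) hy1, map_neg,
    S.bracket_even_even hy0 hz0, S.bracket_odd_odd hy1 hz1]

theorem PartsCommute.mem_center (hS : S.PartsCommute) {i : ZMod 2} {z : L} (hz : z ∈ S.part i)
    (h : ∀ y ∈ S.part i, S.bracket y z = 0) : z ∈ S.center := by
  refine LinearMap.mem_ker.2 (LinearMap.ext fun y => ?_)
  have hij : i ≠ i + 1 := (by decide : ∀ i : ZMod 2, i ≠ i + 1) i
  obtain ⟨y0, hy0, y1, hy1, rfl⟩ := S.exists_add_eq hij y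
  rw [map_add, hS i (i + 1) hij z hz y1 hy1, S.skew i i z y0 hz hy0, h y0 hy0]
  simp

theorem sdim_of_le_even {U : Submodule F L} (hU : U ≤ S.part 0) :
    S.sdim U = (finrank F U, 0) := by
  have h0 : U ⊓ S.part 0 = U := inf_eq_left.2 hU
  have h1 : U ⊓ S.part 1 = ⊥ := (S.isCompl.disjoint.mono_left hU).eq_bot
  rw [sdim, h0, h1, finrank_bot]

/-! ### Sufficiency of the three conditions -/

variable [FiniteDimensional F L]

theorem partsCommute_of_sdim_derived {n : ℕ} (h : S.sdim S.derived = (n, 0)) :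
    S.PartsCommute := by
  have h1 : S.derived ⊓ S.part 1 = ⊥ := Submodule.finrank_eq_zero.1 (congrArg Prod.snd h)
  refine partsCommute_of_even_odd fun x hx y hy => ?_
  have hm : S.bracket x y ∈ S.derived ⊓ S.part 1 :=
    ⟨bracket_mem_derived x y, by simpa using S.bracket_mem 0 1 x y hx hy⟩
  simpa [h1] using hm

omit [FiniteDimensional F L] in
theorem PartsCommute.finrank_derived (hS : S.PartsCommute) {n : ℕ}
    (h : S.sdim S.derived = (n, 0)) : finrank F S.derived = n := by
  rw [sdim_of_le_even hS.derived_le_even] at h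
  exact congrArg Prod.fst h

/-- All images lie in the even part, hence are graded, and only the maximal rank is in question.
Were it at most one, all brackets would lie on a line. -/
theorem PartsCommute.hasSuperbreadth (hS : S.PartsCommute) (hd : 2 ≤ finrank F S.derived)
    (hr : ∀ x, finrank F (LinearMap.range (S.bracket x)) ≤ 2) : S.HasSuperbreadth 2 0 := by
  have hle : ∀ x, LinearMap.range (S.bracket x) ≤ S.part 0 := by
    rintro x _ ⟨y, rfl⟩
    exact hS.derived_le_even (bracket_mem_derived x y)
  obtain ⟨x, hx⟩ : ∃ x, 2 ≤ finrank F (LinearMap.range (S.bracket x)) := by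
    by_contra hne
    push Not at hne
    obtain ⟨u, hu⟩ := LinearMap.exists_forall_eq_smul (B := S.bracket) hS.exists_flip (by
      intro x a b hab
      have hli : LinearIndependent F ![S.bracket x a, S.bracket x b] :=
        LinearIndependent.pair_iff.2 hab
      have hspan : Submodule.span F (Set.range ![S.bracket x a, S.bracket x b]) ≤
          LinearMap.range (S.bracket x) := by
        rw [Submodule.span_le]
        rintro _ ⟨i, rfl⟩
        fin_cases i <;> simp
      have := Submodule.finrank_mono hspan
      rw [finrank_span_eq_card hli, Fintype.card_fin] at this
      exact absurd this (by have := hne x; omega))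
    have hdu : S.derived ≤ Submodule.span F {u} := Submodule.map₂_le.2 fun y _ z _ => by
      obtain ⟨s, hs⟩ := hu y z
      exact Submodule.mem_span_singleton.2 ⟨s, hs.symm⟩
    have h1 := Submodule.finrank_mono hdu
    have h3 := finrank_span_le_card (R := F) ({u} : Set L)
    simp at h3
    omega
  have hx2 := le_antisymm (hr x) hx
  refine ⟨⟨x, ?_, ?_⟩, hr, fun y _ hy => ?_⟩
  · rw [IsGraded, inf_eq_left.2 (hle x)]
    exact sup_eq_left.2 inf_le_left
  · rw [sdim_of_le_even (hle x), hx2]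
  · rw [sdim_of_le_even (hle y)]
    exact hy.le

theorem finrank_quotient_center_le :
    finrank F (L ⧸ S.center) ≤ (S.sdimQuotient S.center).1 + (S.sdimQuotient S.center).2 := by
  have h : (S.part 0).map S.center.mkQ ⊔ (S.part 1).map S.center.mkQ = ⊤ := by
    rw [← Submodule.map_sup, S.isCompl.sup_eq_top, Submodule.map_top, Submodule.range_mkQ]
  rw [← finrank_top F (L ⧸ S.center), ← h]
  exact Submodule.finrank_add_le_finrank_add_finrank _ _

omit [FiniteDimensional F L] in
-- Factoring `ad x` through `L/Z(L)` bounds its rank by the dimension of this quotient.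
theorem PartsCommute.exists_lift (hS : S.PartsCommute) (x : L) :
    ∃ g : (L ⧸ S.center) →ₗ[F] L, LinearMap.range g = LinearMap.range (S.bracket x) ∧
      ∀ y, g (S.center.mkQ y) = S.bracket x y := by
  have h : S.center ≤ LinearMap.ker (S.bracket x) := by
    intro z hz
    obtain ⟨x', hx'⟩ := hS.exists_flip x
    have hz' : S.bracket z = 0 := hz
    rw [LinearMap.mem_ker, hx', hz', LinearMap.zero_apply]
  exact ⟨S.center.liftQ (S.bracket x) h, Submodule.range_liftQ _ _ _,
    fun y => by simp⟩

theorem hasSuperbreadth_of_quotient_odd (hd : S.sdim S.derived = (3, 0))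
    (hq : S.sdimQuotient S.center = (0, 2)) : S.HasSuperbreadth 2 0 := by
  have hS := partsCommute_of_sdim_derived hd
  have hL : finrank F (L ⧸ S.center) ≤ 2 := by simpa [hq] using finrank_quotient_center_le (S := S)
  refine hS.hasSuperbreadth (by rw [hS.finrank_derived hd]; norm_num) fun x => ?_
  obtain ⟨g, hg, -⟩ := hS.exists_lift x
  rw [← hg]
  exact (LinearMap.finrank_range_le g).trans hL

/-- The odd part is central, so `[x, x] = 0` even for inhomogeneous `x`. For noncentral `x` its
class is a nonzero kernel vector of `ad x` on a space of dimension at most three. -/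
theorem hasSuperbreadth_of_quotient_even (h2 : (2 : F) ≠ 0) (hd : S.sdim S.derived = (3, 0))
    (hq : S.sdimQuotient S.center = (3, 0)) : S.HasSuperbreadth 2 0 := by
  have hS := partsCommute_of_sdim_derived hd
  have hL : finrank F (L ⧸ S.center) ≤ 3 := by simpa [hq] using finrank_quotient_center_le (S := S)
  have hodd : (S.part 1).map S.center.mkQ = ⊥ :=
    Submodule.finrank_eq_zero.1 (congrArg Prod.snd hq)
  have hodd' : S.part 1 ≤ S.center := by
    intro y hy
    have : S.center.mkQ y ∈ (S.part 1).map S.center.mkQ := Submodule.mem_map_of_mem hy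
    rw [hodd] at this
    simpa using this
  refine hS.hasSuperbreadth (by rw [hS.finrank_derived hd]; norm_num) fun x => ?_
  obtain ⟨g, hg, hgx⟩ := hS.exists_lift x
  have hxx : S.bracket x x = 0 := by
    have h01 : (0 : ZMod 2) ≠ 1 := by decide
    obtain ⟨x0, hx0, x1, hx1, rfl⟩ := S.exists_add_eq h01 x
    have hx1' : S.bracket x1 = 0 := hodd' hx1
    rw [hS.bracket_add h01 hx0 hx1 hx0 hx1, S.bracket_self_even h2 hx0, hx1']
    simp
  by_cases hx : x ∈ S.center
  · have hx' : S.bracket x = 0 := hx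
    rw [hx', LinearMap.range_zero, finrank_bot]
    exact Nat.zero_le 2
  · have hker : 0 < finrank F (LinearMap.ker g) := by
      rw [Nat.pos_iff_ne_zero, Ne, Submodule.finrank_eq_zero]
      intro hbot
      have hm : S.center.mkQ x ∈ LinearMap.ker g := by rw [LinearMap.mem_ker, hgx, hxx]
      rw [hbot] at hm
      exact hx (by simpa using hm)
    have := LinearMap.finrank_range_add_finrank_ker g
    rw [← hg]
    omega

/-! ### Necessity: the parts commute -/

theorem HasSuperbreadth.partsCommute (h2 : (2 : F) ≠ 0) (h : S.HasSuperbreadth 2 0) :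
    S.PartsCommute := by
  obtain ⟨x, hgr, hdim⟩ := h.attained
  have hr : ∀ y, finrank F (LinearMap.range (S.bracket y)) ≤ 2 := h.finrank_le
  have hle : LinearMap.range (S.bracket x) ≤ S.part 0 := by
    have h1 : LinearMap.range (S.bracket x) ⊓ S.part 1 = ⊥ :=
      Submodule.finrank_eq_zero.1 (congrArg Prod.snd hdim)
    rw [IsGraded, h1, sup_bot_eq] at hgr
    exact inf_eq_left.1 hgr
  obtain ⟨e, f, hef⟩ : ∃ e f, ∀ s t : F,
      s • S.bracket x e + t • S.bracket x f = 0 → s = 0 ∧ t = 0 := by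
    by_contra hne
    have h1 := LinearMap.finrank_range_le_one hne
    rw [sdim_of_le_even hle] at hdim
    have : finrank F (LinearMap.range (S.bracket x)) = 2 := congrArg Prod.fst hdim
    omega
  have hk : ∀ k, S.bracket x k = 0 → ∀ y, S.bracket y k ∈ S.part 0 := fun k hk y =>
    hle (LinearMap.apply_mem_range_of_apply_eq_zero h2 (hr y) (by rw [← map_add]; exact hr _)
      (by rw [← map_sub]; exact hr _) hef hk)
  obtain ⟨x0, hx0, x1, hx1, rfl⟩ := S.exists_add_eq (i := 0) (j := 1) (by decide) x
  have heven : ∀ y, S.bracket (x0 + x1) y ∈ S.part 0 := fun y => hle ⟨y, rfl⟩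
  have h0 : ∀ b ∈ S.part 1, S.bracket x0 b = 0 := by
    intro b hb
    refine S.eq_zero_of_mem ?_ (by simpa using S.bracket_mem 0 1 _ _ hx0 hb)
    have := (S.part 0).sub_mem (heven b) (S.bracket_mem 1 1 _ _ hx1 hb)
    simpa using this
  have h1 : ∀ a ∈ S.part 0, S.bracket x1 a = 0 := by
    intro a ha
    refine S.eq_zero_of_mem ?_ (by simpa using S.bracket_mem 1 0 _ _ hx1 ha)
    have := (S.part 0).sub_mem (heven a) (S.bracket_mem 0 0 _ _ hx0 ha)
    simpa using this
  refine partsCommute_of_even_odd fun a ha b hb => ?_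
  by_contra hab
  have hodd : S.bracket a b ∈ S.part 1 := by simpa using S.bracket_mem 0 1 _ _ ha hb
  have hnot : ∀ c : F, c • S.bracket a b ∈ S.part 0 → c = 0 := by
    intro c hc
    have := S.eq_zero_of_mem hc ((S.part 1).smul_mem c hodd)
    simpa [hab] using this
  -- A relation makes `s • a + t • b` a kernel vector of `ad x`, so its brackets with `b` and `a`
  -- are even. Their odd components are `-s • [a, b]` and `t • [a, b]`.
  have hind : ∀ s t : F, s • S.bracket (x0 + x1) a + t • S.bracket (x0 + x1) b = 0 →
      s = 0 ∧ t = 0 := by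
    intro s t hst
    have hm := hk (s • a + t • b) (by simpa only [map_add, map_smul] using hst)
    constructor
    · have h3 := (S.part 0).sub_mem (hm b)
        ((S.part 0).smul_mem t (S.bracket_mem 1 1 _ _ hb hb))
      have h4 : S.bracket b (s • a + t • b) - t • S.bracket b b = (-s) • S.bracket a b := by
        rw [S.bracket_even_odd ha hb, map_add, map_smul, map_smul]
        module
      rw [h4] at h3
      simpa using hnot _ h3
    · have h3 := (S.part 0).sub_mem (hm a)
        ((S.part 0).smul_mem s (S.bracket_mem 0 0 _ _ ha ha))
      have h4 : S.bracket a (s • a + t • b) - s • S.bracket a a = t • S.bracket a b := by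
        rw [map_add, map_smul, map_smul]
        module
      rw [h4] at h3
      exact hnot _ h3
  have e0 : S.bracket (a + b) x0 = -S.bracket (x0 + x1) a := by
    have hbx : S.bracket b x0 = 0 := by
      have := S.bracket_even_odd hx0 hb
      rw [h0 b hb] at this
      simpa using this.symm
    simp [hbx, h1 a ha, S.bracket_even_even ha hx0]
  have e1 : S.bracket (a + b) x1 = S.bracket (x0 + x1) b := by
    simp [h0 b hb, S.bracket_even_odd ha hx1, h1 a ha, S.bracket_odd_odd hb hx1]
  -- The image of `ad (a + b)` is spanned by its values at `x0` and `x1`, both even; yet its value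
  -- at `a` is the odd vector `-[a, b]`.
  obtain ⟨s, t, hst⟩ := LinearMap.exists_eq_of_finrank_range_le_two (hr (a + b)) (a := x0)
    (b := x1) (by
      intro s t hst
      rw [e0, e1] at hst
      obtain ⟨h3, h4⟩ := hind (-s) t (by linear_combination (norm := module) hst)
      exact ⟨by simpa using h3, h4⟩) a
  rw [e0, e1] at hst
  have hm : S.bracket (a + b) a ∈ S.part 0 := by
    rw [hst]
    exact (S.part 0).add_mem ((S.part 0).smul_mem _ ((S.part 0).neg_mem (heven _)))
      ((S.part 0).smul_mem _ (heven _))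
  have e2 : S.bracket (a + b) a = (-1 : F) • S.bracket a b := by
    rw [S.bracket_even_odd ha hb, map_add, LinearMap.add_apply, S.bracket_self_even h2 ha]
    module
  rw [e2] at hm
  exact one_ne_zero (neg_eq_zero.1 (hnot _ hm))

/-! ### Necessity: reduction to a single homogeneous part -/

variable (S) in
/-- The bracket on one of the two homogeneous parts. -/
noncomputable def partBracket (i : ZMod 2) : S.part i →ₗ[F] S.part i →ₗ[F] L :=
  S.bracket.domRestrict₁₂ (S.part i) (S.part i)

omit [FiniteDimensional F L] in
theorem partBracket_apply {i : ZMod 2} (x y : S.part i) :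
    S.partBracket i x y = S.bracket x y := rfl

theorem finrank_range_partBracket_le {i : ZMod 2} (x : S.part i) :
    finrank F (LinearMap.range (S.partBracket i x)) ≤
      finrank F (LinearMap.range (S.bracket x)) := by
  refine Submodule.finrank_mono ?_
  rintro _ ⟨y, rfl⟩
  exact ⟨y, rfl⟩

omit [FiniteDimensional F L] in
theorem exists_partBracket_flip {i : ZMod 2} (y : S.part i) :
    ∃ y', ∀ z, S.partBracket i y z = S.partBracket i z y' := by
  refine ⟨(-(-1 : F) ^ (i.val * i.val)) • y, fun z => ?_⟩
  rw [map_smul, neg_smul]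
  exact S.skew i i y z y.2 z.2

/-- If some element of one part has rank two and `[L, L]` has dimension greater than two,
then the other part has zero bracket. -/
theorem PartsCommute.bracket_eq_zero (hS : S.PartsCommute)
    (hr : ∀ x, finrank F (LinearMap.range (S.bracket x)) ≤ 2)
    (hd : ∀ u v : L, ¬ S.derived ≤ Submodule.span F {u, v}) {i j : ZMod 2} (hij : i ≠ j)
    {x a b : S.part i} (h : ∀ s t : F, s • S.partBracket i x a + t • S.partBracket i x b = 0 →
      s = 0 ∧ t = 0) :
    ∀ c ∈ S.part j, ∀ d ∈ S.part j, S.bracket c d = 0 := by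
  -- `x + c` acts on part `i` as `x` does, so its image is the plane of `[x, a]` and `[x, b]`; this
  -- image contains `[x + c, d] = [c, d]`.
  have hmem : ∀ x a b : S.part i, (∀ s t : F,
      s • S.partBracket i x a + t • S.partBracket i x b = 0 → s = 0 ∧ t = 0) →
      ∀ c ∈ S.part j, ∀ d ∈ S.part j, ∃ s t : F,
        S.bracket c d = s • S.bracket x a + t • S.bracket x b := by
    intro x a b h c hc d hd
    have e : ∀ y : S.part i, S.bracket (x + c) y = S.bracket x y := fun y => by
      simp [hS j i hij.symm c hc y y.2]
    obtain ⟨s, t, hst⟩ := LinearMap.exists_eq_of_finrank_range_le_two (hr (x + c)) (a := a)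
      (b := b) (by rw [e, e]; exact h) d
    refine ⟨s, t, ?_⟩
    rw [e, e] at hst
    simpa [hS i j hij x x.2 d hd] using hst
  intro c hc d hd'
  by_contra hw
  set w := S.bracket c d with hwdef
  -- The nonzero `w` lies in the image plane of every rank-two element of part `i`. Modulo `w` all
  -- ranks there drop to at most one, so the brackets of part `i` lie in one plane through `w`,
  -- which then contains `[L, L]`.
  obtain ⟨u, hu⟩ := LinearMap.exists_forall_eq_smul
    (B := (S.partBracket i).compr₂ (Submodule.span F {w}).mkQ) (by
      intro y
      obtain ⟨y', hy'⟩ := exists_partBracket_flip y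
      exact ⟨y', fun z => by rw [LinearMap.compr₂_apply, LinearMap.compr₂_apply, hy']⟩) (by
      intro y p q hpq
      have hq : ∀ s t : F, s • S.partBracket i y p + t • S.partBracket i y q = w →
          s = 0 ∧ t = 0 := by
        intro s t hst
        refine hpq s t ?_
        rw [LinearMap.compr₂_apply, LinearMap.compr₂_apply, ← map_smul (Submodule.mkQ _),
          ← map_smul (Submodule.mkQ _), ← map_add, hst]
        simp
      obtain ⟨s, t, hst⟩ := hmem y p q (fun s t hst => hpq s t (by
        rw [LinearMap.compr₂_apply, LinearMap.compr₂_apply, ← map_smul (Submodule.mkQ _),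
          ← map_smul (Submodule.mkQ _), ← map_add, hst, map_zero])) c hc d hd'
      obtain ⟨rfl, rfl⟩ := hq s t hst.symm
      exact hw (by rw [hwdef, hst]; simp))
  obtain ⟨u', rfl⟩ := Submodule.mkQ_surjective _ u
  have hi : ∀ y ∈ S.part i, ∀ z ∈ S.part i, S.bracket y z ∈ Submodule.span F {u', w} := by
    intro y hy z hz
    obtain ⟨s, hs⟩ := hu ⟨y, hy⟩ ⟨z, hz⟩
    rw [LinearMap.compr₂_apply, partBracket_apply, ← map_smul, ← sub_eq_zero, ← map_sub] at hs
    have hs' : S.bracket y z - s • u' ∈ Submodule.span F {w} :=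
      (Submodule.Quotient.mk_eq_zero _).1 hs
    obtain ⟨t, ht⟩ := Submodule.mem_span_singleton.1 hs'
    exact Submodule.mem_span_pair.2 ⟨s, t, by rw [ht]; module⟩
  refine hd u' w (hS.derived_le hij hi fun y hy z hz => ?_)
  obtain ⟨s, t, hst⟩ := hmem x a b h y hy z hz
  rw [hst]
  exact Submodule.add_mem _ (Submodule.smul_mem _ _ (hi _ x.2 _ a.2))
    (Submodule.smul_mem _ _ (hi _ x.2 _ b.2))

omit [FiniteDimensional F L] in
-- Otherwise the brackets of each part lie on a line, and two lines span at most a plane.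
theorem PartsCommute.exists_part_rank_two (hS : S.PartsCommute)
    (hd : ∀ u v : L, ¬ S.derived ≤ Submodule.span F {u, v}) :
    ∃ (i : ZMod 2) (x a b : S.part i), ∀ s t : F,
      s • S.partBracket i x a + t • S.partBracket i x b = 0 → s = 0 ∧ t = 0 := by
  by_contra hne
  have hline : ∀ i, ∃ u : L, ∀ y z, ∃ s : F, S.partBracket i y z = s • u := fun i =>
    LinearMap.exists_forall_eq_smul exists_partBracket_flip
      fun x a b hab => hne ⟨i, x, a, b, hab⟩
  obtain ⟨u, hu⟩ := hline 0
  obtain ⟨v, hv⟩ := hline 1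
  refine hd u v (hS.derived_le (i := 0) (j := 1) (by decide) ?_ ?_)
  · intro x hx y hy
    obtain ⟨s, hs⟩ := hu ⟨x, hx⟩ ⟨y, hy⟩
    exact Submodule.mem_span_pair.2 ⟨s, 0, by rw [← partBracket_apply ⟨x, hx⟩ ⟨y, hy⟩, hs]; simp⟩
  · intro x hx y hy
    obtain ⟨s, hs⟩ := hv ⟨x, hx⟩ ⟨y, hy⟩
    exact Submodule.mem_span_pair.2 ⟨0, s, by rw [← partBracket_apply ⟨x, hx⟩ ⟨y, hy⟩, hs]; simp⟩

/-! ### Necessity: superdimensions of `[L, L]` and `L/Z(L)` from explicit bases -/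

omit [FiniteDimensional F L] in
theorem finrank_eq_of_basis {n : ℕ} {U : Submodule F L} {b : Fin n → L} (hb : ∀ i, b i ∈ U)
    (hspan : U ≤ Submodule.span F (Set.range b)) (hli : LinearIndependent F b) :
    finrank F U = n := by
  have : U = Submodule.span F (Set.range b) :=
    le_antisymm hspan (Submodule.span_le.2 (by rintro _ ⟨i, rfl⟩; exact hb i))
  rw [this, finrank_span_eq_card hli, Fintype.card_fin]

omit [FiniteDimensional F L] in
theorem finrank_map_mkQ {n : ℕ} {U I : Submodule F L} {b : Fin n → L} (hb : ∀ i, b i ∈ U)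
    (hspan : ∀ v ∈ U, ∃ c : Fin n → F, v - ∑ i, c i • b i ∈ I)
    (hind : ∀ c : Fin n → F, ∑ i, c i • b i ∈ I → ∀ i, c i = 0) :
    finrank F (U.map I.mkQ) = n := by
  have hzero : ∀ v, I.mkQ v = 0 ↔ v ∈ I := fun v => by simp
  have hsum : ∀ c : Fin n → F, ∑ i, c i • I.mkQ (b i) = I.mkQ (∑ i, c i • b i) := fun c => by
    rw [map_sum]; simp only [map_smul]
  have hli : LinearIndependent F fun i => I.mkQ (b i) :=
    Fintype.linearIndependent_iff.2 fun c hc => hind c (by rwa [hsum, hzero] at hc)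
  have : U.map I.mkQ = Submodule.span F (Set.range fun i => I.mkQ (b i)) := by
    refine le_antisymm ?_ (Submodule.span_le.2 ?_)
    · rintro _ ⟨v, hv, rfl⟩
      obtain ⟨c, hc⟩ := hspan v hv
      rw [← hzero, map_sub, sub_eq_zero, ← hsum] at hc
      rw [hc]
      exact Submodule.sum_mem _ fun i _ => Submodule.smul_mem _ _ (Submodule.subset_span ⟨i, rfl⟩)
    · rintro _ ⟨i, rfl⟩
      exact Submodule.mem_map_of_mem (hb i)
  rw [this, finrank_span_eq_card hli, Fintype.card_fin]

omit [FiniteDimensional F L] in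
theorem finrank_map_mkQ_eq_zero {U I : Submodule F L} (h : U ≤ I) :
    finrank F (U.map I.mkQ) = 0 := by
  have : U.map I.mkQ = ⊥ := by
    rw [eq_bot_iff]
    rintro _ ⟨v, hv, rfl⟩
    simpa using h hv
  rw [this, finrank_bot]

omit [FiniteDimensional F L] in
theorem linearIndependent_three {p q r : L}
    (h : ∀ s t c : F, s • p + t • q + c • r = 0 → s = 0 ∧ t = 0 ∧ c = 0) :
    LinearIndependent F ![p, q, r] :=
  Fintype.linearIndependent_iff.2 fun g hg => by
    obtain ⟨h0, h1, h2⟩ := h (g 0) (g 1) (g 2) (by simpa [Fin.sum_univ_three] using hg)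
    intro i
    fin_cases i <;> assumption

omit [FiniteDimensional F L] in
theorem mem_span_three {p q r v : L} {s t c : F} (h : v = s • p + t • q + c • r) :
    v ∈ Submodule.span F (Set.range ![p, q, r]) := by
  have hm : ∀ i, ![p, q, r] i ∈ Submodule.span F (Set.range ![p, q, r]) := fun i =>
    Submodule.subset_span ⟨i, rfl⟩
  rw [h]
  exact Submodule.add_mem _ (Submodule.add_mem _ (Submodule.smul_mem _ _ (hm 0))
    (Submodule.smul_mem _ _ (hm 1))) (Submodule.smul_mem _ _ (hm 2))

theorem PartsCommute.sdim_of_even_rank_two (h2 : (2 : F) ≠ 0) (hS : S.PartsCommute)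
    (hr : ∀ x, finrank F (LinearMap.range (S.bracket x)) ≤ 2)
    (hd : ∀ u v : L, ¬ S.derived ≤ Submodule.span F {u, v}) {x e f : S.part 0}
    (h : ∀ s t : F, s • S.partBracket 0 x e + t • S.partBracket 0 x f = 0 → s = 0 ∧ t = 0) :
    S.sdim S.derived = (3, 0) ∧ S.sdimQuotient S.center = (3, 0) := by
  have h01 : (0 : ZMod 2) ≠ 1 := by decide
  have hodd := hS.bracket_eq_zero hr hd h01 h
  have halt : ∀ y, S.partBracket 0 y y = 0 := fun y => S.bracket_self_even h2 y.2
  have hneg : ∀ y z, S.partBracket 0 y z = -S.partBracket 0 z y := fun y z =>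
    S.bracket_even_even y.2 z.2
  obtain ⟨hind, hdec⟩ := LinearMap.exists_three_of_alternating h2 halt
    (fun y => (finrank_range_partBracket_le y).trans (hr y))
    (fun u v huv => hd u v (hS.derived_le h01 (fun y hy z hz => by
      obtain ⟨s, t, hst⟩ := huv ⟨y, hy⟩ ⟨z, hz⟩
      exact Submodule.mem_span_pair.2 ⟨s, t, hst.symm⟩) (fun y hy z hz => by
      rw [hodd y hy z hz]; exact Submodule.zero_mem _))) h
  constructor
  · rw [sdim_of_le_even hS.derived_le_even]
    congr 1
    refine finrank_eq_of_basis (b := ![S.partBracket 0 x e, S.partBracket 0 x f,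
      S.partBracket 0 e f]) ?_ ?_ (linearIndependent_three hind)
    · intro i
      fin_cases i <;> exact bracket_mem_derived _ _
    · refine hS.derived_le h01 (fun y hy z hz => ?_)
        (fun y hy z hz => by rw [hodd y hy z hz]; exact Submodule.zero_mem _)
      lift y to S.part 0 using hy
      lift z to S.part 0 using hz
      obtain ⟨a, b, c, hy⟩ := hdec y
      obtain ⟨a', b', c', hz⟩ := hdec z
      have hzy := hz y
      have hyx := hy x
      have hye := hy e
      have hyf := hy f
      simp only [map_sub, map_smul, halt, hneg e x, hneg f x, hneg f e, hneg x y, hneg e y,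
        hneg f y] at hzy hyx hye hyf
      -- The coefficients are the 2×2 minors of the coordinates of `y` and `z`, as for `y ∧ z`.
      refine mem_span_three (s := a * b' - b * a') (t := a * c' - c * a')
        (c := b * c' - c * b') ?_
      rw [← partBracket_apply]
      linear_combination (norm := module) hzy - a' • hyx - b' • hye - c' • hyf
  · refine Prod.ext ?_ (finrank_map_mkQ_eq_zero fun z hz => hS.mem_center hz
      fun y hy => hodd y hy z hz)
    refine finrank_map_mkQ (b := ![(x : L), e, f]) ?_ ?_ ?_
    · intro i
      fin_cases i
      exacts [x.2, e.2, f.2]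
    · intro v hv
      obtain ⟨a, b, c, hk⟩ := hdec ⟨v, hv⟩
      refine ⟨![a, b, c], ?_⟩
      have heq : v - ∑ i, ![a, b, c] i • ![(x : L), e, f] i =
          ((⟨v, hv⟩ - a • x - b • e - c • f : S.part 0) : L) := by
        simp [Fin.sum_univ_three]
        abel
      rw [heq]
      exact hS.mem_center (Subtype.prop _) fun y hy => hk ⟨y, hy⟩
    · intro c hc
      have hz : S.bracket (∑ i, c i • ![(x : L), e, f] i) = 0 := hc
      have hx := LinearMap.congr_fun hz x
      have he := LinearMap.congr_fun hz e
      simp only [Fin.sum_univ_three, Matrix.cons_val, map_add, map_smul, LinearMap.add_apply,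
        LinearMap.smul_apply, ← partBracket_apply, halt, LinearMap.zero_apply, hneg e x,
        hneg f x, hneg f e] at hx he
      -- Bracketing a central combination with `x` determines its coefficients at `e` and `f`;
      -- bracketing with `e` determines the one at `x`.
      obtain ⟨h1, h3, -⟩ := hind (-c 1) (-c 2) 0 (by linear_combination (norm := module) hx)
      obtain ⟨h0, -, -⟩ := hind (c 0) 0 (-c 2) (by linear_combination (norm := module) he)
      intro i
      fin_cases i
      exacts [h0, neg_eq_zero.1 h1, neg_eq_zero.1 h3]

theorem PartsCommute.sdim_of_odd_rank_two (h2 : (2 : F) ≠ 0) (hS : S.PartsCommute)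
    (hr : ∀ x, finrank F (LinearMap.range (S.bracket x)) ≤ 2)
    (hd : ∀ u v : L, ¬ S.derived ≤ Submodule.span F {u, v}) {x a b : S.part 1}
    (h : ∀ s t : F, s • S.partBracket 1 x a + t • S.partBracket 1 x b = 0 → s = 0 ∧ t = 0) :
    S.sdim S.derived = (3, 0) ∧ S.sdimQuotient S.center = (0, 2) := by
  have h10 : (1 : ZMod 2) ≠ 0 := by decide
  have heven := hS.bracket_eq_zero hr hd h10 h
  have hsymm : ∀ y z, S.partBracket 1 y z = S.partBracket 1 z y := fun y z =>
    S.bracket_odd_odd y.2 z.2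
  obtain ⟨e, hind, hdec⟩ := LinearMap.exists_two_of_symmetric h2 hsymm
    (fun y => (finrank_range_partBracket_le y).trans (hr y))
    (fun u v huv => hd u v (hS.derived_le h10 (fun y hy z hz => by
      obtain ⟨s, t, hst⟩ := huv ⟨y, hy⟩ ⟨z, hz⟩
      exact Submodule.mem_span_pair.2 ⟨s, t, hst.symm⟩) (fun y hy z hz => by
      rw [heven y hy z hz]; exact Submodule.zero_mem _))) h
  constructor
  · rw [sdim_of_le_even hS.derived_le_even]
    congr 1
    refine finrank_eq_of_basis (b := ![S.partBracket 1 x x, S.partBracket 1 x e,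
      S.partBracket 1 e e]) ?_ ?_ (linearIndependent_three hind)
    · intro i
      fin_cases i <;> exact bracket_mem_derived _ _
    · refine hS.derived_le h10 (fun y hy z hz => ?_)
        (fun y hy z hz => by rw [heven y hy z hz]; exact Submodule.zero_mem _)
      lift y to S.part 1 using hy
      lift z to S.part 1 using hz
      obtain ⟨a, b, hy⟩ := hdec y
      obtain ⟨a', b', hz⟩ := hdec z
      have hzy := hz y
      have hyx := hy x
      have hye := hy e
      simp only [map_sub, map_smul, hsymm e x, hsymm x y, hsymm e y] at hzy hyx hye
      refine mem_span_three (s := a * a') (t := a * b' + b * a') (c := b * b') ?_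
      rw [← partBracket_apply]
      linear_combination (norm := module) hzy + a' • hyx + b' • hye
  · refine Prod.ext (finrank_map_mkQ_eq_zero fun z hz => hS.mem_center hz
      fun y hy => heven y hy z hz) ?_
    refine finrank_map_mkQ (b := ![(x : L), e]) ?_ ?_ ?_
    · intro i
      fin_cases i
      exacts [x.2, e.2]
    · intro v hv
      obtain ⟨a, b, hk⟩ := hdec ⟨v, hv⟩
      refine ⟨![a, b], ?_⟩
      have heq : v - ∑ i, ![a, b] i • ![(x : L), e] i =
          ((⟨v, hv⟩ - a • x - b • e : S.part 1) : L) := by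
        simp [Fin.sum_univ_two]
        abel
      rw [heq]
      exact hS.mem_center (Subtype.prop _) fun y hy => hk ⟨y, hy⟩
    · intro c hc
      have hz : S.bracket (∑ i, c i • ![(x : L), e] i) = 0 := hc
      have hx := LinearMap.congr_fun hz x
      simp only [Fin.sum_univ_two, Matrix.cons_val_zero, Matrix.cons_val_one, map_add, map_smul,
        LinearMap.add_apply, LinearMap.smul_apply, ← partBracket_apply, LinearMap.zero_apply,
        hsymm e x] at hx
      obtain ⟨h0, h1, -⟩ := hind (c 0) (c 1) 0 (by linear_combination (norm := module) hx)
      intro i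
      fin_cases i
      exacts [h0, h1]

end LieSuperalgebra

/-! ### The classification -/

theorem mainTheorem1 {F : Type u} {L : Type v} [Field F] (hF : (2 : F) ≠ 0)
    [AddCommGroup L] [Module F L] [FiniteDimensional F L]
    (S : LieSuperalgebra F L) (hS : S.IsNilpotent) :
    S.HasSuperbreadth 2 0 ↔
      S.sdim S.derived = (2, 0) ∨
      (S.sdim S.derived = (3, 0) ∧ S.sdimQuotient S.center = (0, 2)) ∨
      (S.sdim S.derived = (3, 0) ∧ S.sdimQuotient S.center = (3, 0)) := by
  constructor
  · intro h
    have hc := h.partsCommute hF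
    have hr : ∀ y, finrank F (LinearMap.range (S.bracket y)) ≤ 2 := h.finrank_le
    by_cases hd : finrank F S.derived = 2
    · left
      rw [LieSuperalgebra.sdim_of_le_even hc.derived_le_even, hd]
    right
    -- `[L, L]` contains an image of dimension two, so a dimension other than two is at least three.
    have hspan : ∀ u v : L, ¬ S.derived ≤ Submodule.span F {u, v} := by
      intro u v huv
      obtain ⟨x, -, hx⟩ := h.attained
      have hle : LinearMap.range (S.bracket x) ≤ S.derived := by
        rintro _ ⟨y, rfl⟩
        exact LieSuperalgebra.bracket_mem_derived x y
      rw [LieSuperalgebra.sdim_of_le_even (hle.trans hc.derived_le_even)] at hx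
      have h1 : finrank F (LinearMap.range (S.bracket x)) = 2 := congrArg Prod.fst hx
      have h2 := Submodule.finrank_mono hle
      have h3 := Submodule.finrank_mono huv
      have h4 := (finrank_range_le_card (R := F) ![u, v])
      rw [Set.finrank, Matrix.range_cons_cons_empty, Fintype.card_fin] at h4
      omega
    obtain ⟨i, x, a, b, hab⟩ := hc.exists_part_rank_two hspan
    have hi : i = 0 ∨ i = 1 := (by decide : ∀ i : ZMod 2, i = 0 ∨ i = 1) i
    rcases hi with rfl | rfl
    · exact Or.inr (hc.sdim_of_even_rank_two hF hr hspan hab)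
    · exact Or.inl (hc.sdim_of_odd_rank_two hF hr hspan hab)
  · rintro (h | ⟨h, hq⟩ | ⟨h, hq⟩)
    · have hc := LieSuperalgebra.partsCommute_of_sdim_derived h
      have hd := hc.finrank_derived h
      refine hc.hasSuperbreadth hd.ge fun x => ?_
      rw [← hd]
      refine Submodule.finrank_mono ?_
      rintro _ ⟨y, rfl⟩
      exact LieSuperalgebra.bracket_mem_derived x y
    · exact LieSuperalgebra.hasSuperbreadth_of_quotient_odd h hq
    · exact LieSuperalgebra.hasSuperbreadth_of_quotient_even hF h hq
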